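/- Let $f=f(x,u,v,w)$ be a $C^1$ function on $S^1\times\mathbb R^3$, $S^1=\mathbb R/\mathbb Z$, such that (f1) there is $\lambda>0$ with $\lambda\le \partial_w f(x,u,v,w)\le\lambda^{-1}$ for all $(x,u,v,w)\in S^1\times\mathbb R^3$; (f2) there is $\gamma\in(0,2)$ such that for every $R$ there is $C>0$ with $|f(x,u,v,w)|\le C(1+|v|^\gamma)$ for all $x\in S^1$, $v\in\mathbb R$ and $|u|,|w|\le R$. A stationary solution of $u_t=f(x,u,u_x,u_{xx})$ is a $C^2$ function $u$ with $f(x,u,u_x,u_{xx})=0$ for all $x$. Let $\mathbf v=\{v^\alpha\}_{\alpha=1}^n$ be a stationary braid: the strands $v^\alpha$ are stationary solutions on $[0,1]$ which close up under a permutation $\tau$ of $\{1,\dots,n\}$ (that is, $v^\alpha$ extends to a stationary solution on $\mathbb R$ with $v^\alpha(x+1)=v^{\tau(\alpha)}(x)$ for all $x$), and wherever two different strands meet, their difference has an isolated sign change. Assume that $\mathbf v$ is nontrivially braided, i.e. the number $\iota(\mathbf v)$ of intersections of strands of $\mathbf v$ over $S^1$ is nonzero. (i) Assume that no single strand of $\mathbf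 v$ lies above all other strands over the whole circle. Let $u^*$ be a constant with $v^\alpha(x)<u^*$ for all $\alpha$ and $x$, and $f(x,u^*,0,0)<0$ for all $x\in S^1$. Then there is a $1$-periodic stationary solution $u$ with $\max_\alpha v^\alpha(x)<u(x)<u^*$ for all $x\in S^1$. (ii) Assume that no single strand of $\mathbf v$ lies below all other strands over the whole circle. Let $u^*$ be a constant with $u^*<v^\alpha(x)$ for all $\alpha$ and $x$, and $f(x,u^*,0,0)>0$ for all $x\in S^1$. Then there is a $1$-periodic stationary solution $u$ with $u^*<u(x)<\min_\alpha v^\alpha(x)$ for all $x\in S^1$. -/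

import Mathlib

/-- `f = f(x,u,v,w)` is a `C¹` function on `S¹ × ℝ³`, where `S¹ = ℝ/ℤ`: a `C¹` function on `ℝ⁴`
which is `1`-periodic in `x`. -/
structure IsCircleNonlinearity (f : ℝ → ℝ → ℝ → ℝ → ℝ) : Prop where
  contDiff : ContDiff ℝ 1 fun p : ℝ × ℝ × ℝ × ℝ => f p.1 p.2.1 p.2.2.1 p.2.2.2
  periodic : ∀ x u v w, f (x + 1) u v w = f x u v w

/-- Uniform parabolicity: `0 < lam ≤ ∂f/∂w ≤ lam⁻¹` everywhere. -/
def UniformlyParabolic (f : ℝ → ℝ → ℝ → ℝ → ℝ) : Prop :=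
  ∃ lam : ℝ, 0 < lam ∧ ∀ x u v w : ℝ,
    lam ≤ deriv (fun s => f x u v s) w ∧ deriv (fun s => f x u v s) w ≤ lam⁻¹

/-- Sub-quadratic growth in the variable `v = u_x`, uniformly in `x` and on compact intervals
in `u` and `w`. -/
def SubquadraticGrowth (f : ℝ → ℝ → ℝ → ℝ → ℝ) : Prop :=
  ∃ γ : ℝ, 0 < γ ∧ γ < 2 ∧ ∀ R : ℝ, ∃ C : ℝ, 0 < C ∧
    ∀ x u v w : ℝ, |u| ≤ R → |w| ≤ R → |f x u v w| ≤ C * (1 + |v| ^ γ)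

/-- `u` is a (classical, `C²`) stationary solution of `u_t = f(x,u,u_x,u_xx)` on the real line. -/
def IsStationarySolution (f : ℝ → ℝ → ℝ → ℝ → ℝ) (u : ℝ → ℝ) : Prop :=
  ContDiff ℝ 2 u ∧ ∀ x, f x (u x) (deriv u x) (deriv (deriv u) x) = 0

/-- The function `d` has an isolated sign change at `x`. -/
def HasIsolatedSignChange (d : ℝ → ℝ) (x : ℝ) : Prop :=
  ∃ ε : ℝ, 0 < ε ∧ ∀ y ∈ Set.Ioo (x - ε) x, ∀ z ∈ Set.Ioo x (x + ε), d y * d z < 0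

/-- A closed positive braid diagram on `n` strands whose strands are stationary solutions of
`u_t = f(x,u,u_x,u_xx)`. The strands on `[0,1]` are glued at the ends by the permutation `τ`, and
each strand is represented by its continuation to the whole line through this gluing: the part of
the continued strand `α` over `[1,2]` is the strand `τ α`, translated by `1`. -/
structure IsStationaryBraid (f : ℝ → ℝ → ℝ → ℝ → ℝ) {n : ℕ} (τ : Equiv.Perm (Fin n))
    (v : Fin n → ℝ → ℝ) : Prop where
  stationary : ∀ α, IsStationarySolution f (v α)
  periodic : ∀ α x, v α (x + 1) = v (τ α) x
  transverse : ∀ α β, α ≠ β → ∀ x, v α x = v β x →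
    HasIsolatedSignChange (fun y => v α y - v β y) x

/-- The length `ι(v)` of a closed braid diagram: the total number of intersections of its strands
over the circle (with fundamental domain `[0,1)`). -/
noncomputable def braidLength {n : ℕ} (v : Fin n → ℝ → ℝ) : ℕ∞ :=
  Set.encard {p : (Fin n × Fin n) × ℝ |
    p.1.1 < p.1.2 ∧ p.2 ∈ Set.Ico (0 : ℝ) 1 ∧ v p.1.1 p.2 = v p.1.2 p.2}

/-- Some strand of `v` lies above all strands of `v` over the whole circle. -/
def HasTopStrand {n : ℕ} (v : Fin n → ℝ → ℝ) : Prop :=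
  ∃ α, ∀ β x, v β x ≤ v α x

/-- Some strand of `v` lies below all strands of `v` over the whole circle. -/
def HasBottomStrand {n : ℕ} (v : Fin n → ℝ → ℝ) : Prop :=
  ∃ α, ∀ β x, v α x ≤ v β x

open Set MeasureTheory BoundedContinuousFunction

/-! By (f1), `f = 0` can be solved for the second derivative, so stationary solutions are the
solutions of an ODE `u'' = g(x,u,u')`. The strands are periodic solutions of it (with a longer
period in general) and, in case (i), the constant `u*` is a strict supersolution above them. A
monotone iteration starting at `u*` decreases, stays above every strand, and converges to a
1-periodic solution `u` (`exists_solution_between`). The iteration needs a bounded, globally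
Lipschitz right-hand side, so `u` and `u'` are first truncated. Subquadratic growth gives Nagumo's a
priori bound on `u'` (`abs_deriv_lt_of_subquadratic`), valid for the strands and for the truncated
problem alike, so the truncation is never felt. Strictness: if `u` touches a strand from above, it
is tangent to it, and ODE uniqueness makes them equal (`IsLipschitzForcing.eq_of_initial_eq`); that
strand would then lie above all others, which is excluded. Touching `u*` contradicts `f(x,u*,0,0) <
0`. Case (ii) is case (i) for `-u`. -/

/-! ### Bounded solutions of `k² u - u'' = h` on the line -/

/-- The exponentially weighted average `∫₀^∞ exp (-k s) h (x + s) ds` of `h` to the right of `x`. -/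
noncomputable def expAverage (k : ℝ) (h : ℝ → ℝ) (x : ℝ) : ℝ :=
  ∫ s in Ioi (0 : ℝ), Real.exp (-k * s) * h (x + s)

theorem integrableOn_exp_mul_comp_add {k : ℝ} (hk : 0 < k) {h : ℝ → ℝ} (hc : Continuous h) {M : ℝ}
    (hM : ∀ x, |h x| ≤ M) (x a : ℝ) :
    IntegrableOn (fun s => Real.exp (-k * s) * h (x + s)) (Ioi a) := by
  refine Integrable.mul_bdd (c := M) (exp_neg_integrableOn_Ioi a hk) ?_ ?_
  · exact (hc.comp (continuous_const.add continuous_id)).aestronglyMeasurable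
  · exact Filter.Eventually.of_forall fun s => by simpa using hM (x + s)

theorem integral_exp_neg_mul_Ioi_zero {k : ℝ} (hk : 0 < k) :
    ∫ s in Ioi (0 : ℝ), Real.exp (-k * s) = 1 / k := by
  rw [integral_exp_mul_Ioi (by linarith)]
  simp

theorem abs_expAverage_le {k : ℝ} (hk : 0 < k) {h : ℝ → ℝ} {M : ℝ}
    (hM : ∀ x, |h x| ≤ M) (x : ℝ) : |expAverage k h x| ≤ M / k := by
  have h1 : |expAverage k h x| ≤ ∫ s in Ioi (0 : ℝ), Real.exp (-k * s) * M := by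
    refine norm_integral_le_of_norm_le (f := fun s => Real.exp (-k * s) * h (x + s)) (Integrable.mul_const (exp_neg_integrableOn_Ioi 0 hk) M) ?_
    refine Filter.Eventually.of_forall fun s => ?_
    rw [norm_mul, Real.norm_of_nonneg (Real.exp_pos _).le]
    exact mul_le_mul_of_nonneg_left (hM _) (Real.exp_pos _).le
  rw [integral_mul_const, integral_exp_neg_mul_Ioi_zero hk] at h1
  calc _ ≤ _ := h1
    _ = M / k := by ring

theorem expAverage_sub {k : ℝ} (hk : 0 < k) {h₁ h₂ : ℝ → ℝ} (hc₁ : Continuous h₁)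
    (hc₂ : Continuous h₂) {M₁ M₂ : ℝ} (hM₁ : ∀ x, |h₁ x| ≤ M₁) (hM₂ : ∀ x, |h₂ x| ≤ M₂) (x : ℝ) :
    expAverage k (fun y => h₁ y - h₂ y) x = expAverage k h₁ x - expAverage k h₂ x := by
  unfold expAverage
  rw [← integral_sub (integrableOn_exp_mul_comp_add hk hc₁ hM₁ x 0)
    (integrableOn_exp_mul_comp_add hk hc₂ hM₂ x 0)]
  simp only [mul_sub]

/-- Moves `x` from the argument of `h` to the domain of integration, so that the average can be
differentiated although `h` is only continuous. -/
theorem expAverage_eq_exp_mul (k : ℝ) (h : ℝ → ℝ) (x : ℝ) :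
    expAverage k h x = Real.exp (k * x) * ∫ y in Ioi x, Real.exp (-k * y) * h y := by
  unfold expAverage
  rw [← integral_const_mul, ← integral_indicator measurableSet_Ioi,
    ← integral_indicator measurableSet_Ioi, ← integral_add_left_eq_self (Set.indicator (Ioi x) _) x]
  congr 1
  ext s
  by_cases hs : 0 < s
  · rw [indicator_of_mem (by simpa using hs), indicator_of_mem (by simpa using hs), ← mul_assoc,
      ← Real.exp_add]
    ring_nf
  · rw [indicator_of_notMem (by simpa using hs), indicator_of_notMem (by simpa using hs)]

theorem hasDerivAt_expAverage {k : ℝ} (hk : 0 < k) {h : ℝ → ℝ} (hc : Continuous h) {M : ℝ}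
    (hM : ∀ x, |h x| ≤ M) (x : ℝ) :
    HasDerivAt (expAverage k h) (k * expAverage k h x - h x) x := by
  have hint : ∀ a, IntegrableOn (fun y => Real.exp (-k * y) * h y) (Ioi a) := fun a => by
    simpa using integrableOn_exp_mul_comp_add hk hc hM 0 a
  have hcont : Continuous fun y => Real.exp (-k * y) * h y := by fun_prop
  have heq : expAverage k h = fun x => Real.exp (k * x) *
      ((∫ y in Ioi 0, Real.exp (-k * y) * h y) - ∫ y in (0 : ℝ)..x, Real.exp (-k * y) * h y) := by
    ext x
    rw [expAverage_eq_exp_mul, ← intervalIntegral.integral_Ioi_sub_Ioi' (hint 0) (hint x)]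
    ring
  have hx := congrFun heq x
  rw [heq]
  beta_reduce
  rw [← hx]
  have h1 : HasDerivAt (fun x => Real.exp (k * x)) (Real.exp (k * x) * k) x := by
    simpa using ((hasDerivAt_id x).const_mul k).exp
  have h2 := (intervalIntegral.integral_hasDerivAt_right
    (hcont.intervalIntegrable 0 x) (hcont.stronglyMeasurableAtFilter _ _) hcont.continuousAt).const_sub
    (∫ y in Ioi 0, Real.exp (-k * y) * h y)
  refine (h1.mul h2).congr_deriv ?_
  rw [hx]
  have : Real.exp (k * x) * Real.exp (-k * x) = 1 := by rw [← Real.exp_add]; simp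
  linear_combination (-(h x)) * this

/-- The bounded solution `u` of `k² u - u'' = h`. -/
noncomputable def greenSol (k : ℝ) (h : ℝ → ℝ) (x : ℝ) : ℝ :=
  (expAverage k h x + expAverage k (fun y => h (-y)) (-x)) / (2 * k)

/-- The derivative of the bounded solution `u` of `k² u - u'' = h`. -/
noncomputable def greenSolDeriv (k : ℝ) (h : ℝ → ℝ) (x : ℝ) : ℝ :=
  (expAverage k h x - expAverage k (fun y => h (-y)) (-x)) / 2

theorem hasDerivAt_expAverage_neg {k : ℝ} (hk : 0 < k) {h : ℝ → ℝ} (hc : Continuous h) {M : ℝ}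
    (hM : ∀ x, |h x| ≤ M) (x : ℝ) :
    HasDerivAt (fun x => expAverage k (fun y => h (-y)) (-x))
      (h x - k * expAverage k (fun y => h (-y)) (-x)) x := by
  have h1 := hasDerivAt_expAverage hk (hc.comp continuous_neg) (fun x => hM (-x)) (-x)
  refine (h1.comp x (hasDerivAt_neg x)).congr_deriv ?_
  simp [Function.comp_def]

theorem hasDerivAt_greenSol {k : ℝ} (hk : 0 < k) {h : ℝ → ℝ} (hc : Continuous h) {M : ℝ}
    (hM : ∀ x, |h x| ≤ M) (x : ℝ) : HasDerivAt (greenSol k h) (greenSolDeriv k h x) x := by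
  refine (((hasDerivAt_expAverage hk hc hM x).add
    (hasDerivAt_expAverage_neg hk hc hM x)).div_const (2 * k)).congr_deriv ?_
  unfold greenSolDeriv
  field_simp
  ring

theorem hasDerivAt_greenSolDeriv {k : ℝ} (hk : 0 < k) {h : ℝ → ℝ} (hc : Continuous h) {M : ℝ}
    (hM : ∀ x, |h x| ≤ M) (x : ℝ) :
    HasDerivAt (greenSolDeriv k h) (k ^ 2 * greenSol k h x - h x) x := by
  refine (((hasDerivAt_expAverage hk hc hM x).sub
    (hasDerivAt_expAverage_neg hk hc hM x)).div_const 2).congr_deriv ?_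
  unfold greenSol
  field_simp
  ring

theorem abs_greenSol_le {k : ℝ} (hk : 0 < k) {h : ℝ → ℝ} {M : ℝ}
    (hM : ∀ x, |h x| ≤ M) (x : ℝ) : |greenSol k h x| ≤ M / k ^ 2 := by
  have h1 := abs_expAverage_le hk hM x
  have h2 := abs_expAverage_le hk (fun x => hM (-x)) (-x)
  unfold greenSol
  rw [abs_div, abs_of_pos (by linarith : 0 < 2 * k), div_le_iff₀ (by linarith)]
  calc _ ≤ M / k + M / k := (abs_add_le _ _).trans (add_le_add h1 h2)
    _ = _ := by field_simp; ring

theorem abs_greenSolDeriv_le {k : ℝ} (hk : 0 < k) {h : ℝ → ℝ} {M : ℝ}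
    (hM : ∀ x, |h x| ≤ M) (x : ℝ) : |greenSolDeriv k h x| ≤ M / k := by
  have h1 := abs_expAverage_le hk hM x
  have h2 := abs_expAverage_le hk (fun x => hM (-x)) (-x)
  unfold greenSolDeriv
  rw [abs_div, abs_of_pos (by norm_num : (0 : ℝ) < 2), div_le_iff₀ (by norm_num)]
  calc _ ≤ M / k + M / k := (abs_sub _ _).trans (add_le_add h1 h2)
    _ = _ := by ring

theorem abs_greenSol_sub_le {k : ℝ} (hk : 0 < k) (h₁ h₂ : ℝ →ᵇ ℝ) (x : ℝ) :
    |greenSol k h₁ x - greenSol k h₂ x| ≤ dist h₁ h₂ / k ^ 2 := by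
  have hM : ∀ (h : ℝ →ᵇ ℝ) x, |h x| ≤ ‖h‖ := fun h x => h.norm_coe_le_norm x
  have h1 := abs_greenSol_le hk (h := fun y => h₁ y - h₂ y) (M := dist h₁ h₂)
    (fun x => by simpa [Real.dist_eq] using dist_coe_le_dist (f := h₁) (g := h₂) x) x
  convert h1 using 2
  unfold greenSol
  have e := expAverage_sub hk (h₁.continuous.comp continuous_neg)
    (h₂.continuous.comp continuous_neg) (fun x => hM h₁ (-x)) (fun x => hM h₂ (-x)) (-x)
  simp only [Function.comp_def] at e
  rw [e, expAverage_sub hk h₁.continuous h₂.continuous (hM h₁) (hM h₂)]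
  ring

theorem abs_greenSolDeriv_sub_le {k : ℝ} (hk : 0 < k) (h₁ h₂ : ℝ →ᵇ ℝ) (x : ℝ) :
    |greenSolDeriv k h₁ x - greenSolDeriv k h₂ x| ≤ dist h₁ h₂ / k := by
  have hM : ∀ (h : ℝ →ᵇ ℝ) x, |h x| ≤ ‖h‖ := fun h x => h.norm_coe_le_norm x
  have h1 := abs_greenSolDeriv_le hk (h := fun y => h₁ y - h₂ y) (M := dist h₁ h₂)
    (fun x => by simpa [Real.dist_eq] using dist_coe_le_dist (f := h₁) (g := h₂) x) x
  convert h1 using 2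
  unfold greenSolDeriv
  have e := expAverage_sub hk (h₁.continuous.comp continuous_neg)
    (h₂.continuous.comp continuous_neg) (fun x => hM h₁ (-x)) (fun x => hM h₂ (-x)) (-x)
  simp only [Function.comp_def] at e
  rw [e, expAverage_sub hk h₁.continuous h₂.continuous (hM h₁) (hM h₂)]
  ring

theorem expAverage_comp_add (k : ℝ) (h : ℝ → ℝ) (c x : ℝ) :
    expAverage k (fun y => h (y + c)) x = expAverage k h (x + c) := by
  unfold expAverage
  simp only [add_right_comm]

theorem expAverage_comp_add_neg (k : ℝ) (h : ℝ → ℝ) (c x : ℝ) :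
    expAverage k (fun y => h (-y + c)) (-x) = expAverage k (fun y => h (-y)) (-(x + c)) := by
  have e : ∀ s, -(-x + s) + c = -(-(x + c) + s) := fun s => by ring
  simp only [expAverage, e]

theorem greenSol_comp_add (k : ℝ) (h : ℝ → ℝ) (c x : ℝ) :
    greenSol k (fun y => h (y + c)) x = greenSol k h (x + c) := by
  simp only [greenSol, expAverage_comp_add, expAverage_comp_add_neg]

theorem greenSolDeriv_comp_add (k : ℝ) (h : ℝ → ℝ) (c x : ℝ) :
    greenSolDeriv k (fun y => h (y + c)) x = greenSolDeriv k h (x + c) := by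
  simp only [greenSolDeriv, expAverage_comp_add, expAverage_comp_add_neg]

/-! ### Maximum and comparison principles for periodic functions -/

/-- A bounded continuous right-hand side `G(x,u,v)`, `1`-periodic in `x` and Lipschitz in `(u,v)`. -/
structure IsLipschitzForcing (G : ℝ → ℝ → ℝ → ℝ) (L B : ℝ) : Prop where
  nonneg : 0 ≤ L
  cont : Continuous fun p : ℝ × ℝ × ℝ => G p.1 p.2.1 p.2.2
  bdd : ∀ x u v, |G x u v| ≤ B
  lip : ∀ x u v u' v', |G x u v - G x u' v'| ≤ L * (|u - u'| + |v - v'|)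
  periodic : ∀ x u v, G (x + 1) u v = G x u v

theorem Function.Periodic.exists_forall_le {d : ℝ → ℝ} {T : ℝ} (hd : Function.Periodic d T)
    (hT : 0 < T) (hc : Continuous d) : ∃ x₀, ∀ y, d y ≤ d x₀ := by
  obtain ⟨x₀, -, h⟩ := isCompact_Icc.exists_isMaxOn (nonempty_Icc.2 hT.le) hc.continuousOn
  refine ⟨x₀, fun y => ?_⟩
  obtain ⟨z, hz, he⟩ := hd.exists_mem_Ico₀ hT y
  rw [he]
  exact h (Ico_subset_Icc_self hz)

theorem deriv_eq_zero_and_second_deriv_nonpos_of_max {d d' d'' : ℝ → ℝ}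
    (h1 : ∀ x, HasDerivAt d (d' x) x) (h2 : ∀ x, HasDerivAt d' (d'' x) x) {x₀ : ℝ}
    (hmax : ∀ y, d y ≤ d x₀) : d' x₀ = 0 ∧ d'' x₀ ≤ 0 := by
  have hlm : IsLocalMax d x₀ := Filter.Eventually.of_forall hmax
  have h0 := hlm.hasDerivAt_eq_zero (h1 x₀)
  refine ⟨h0, ?_⟩
  by_contra! hpos
  have e1 : deriv d = d' := funext fun x => (h1 x).deriv
  have e2 : deriv d' = d'' := funext fun x => (h2 x).deriv
  -- A positive second derivative would make the maximum a local minimum too, so `d` would be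
  -- locally constant, forcing `d'' x₀ = 0`.
  have hmin : IsLocalMin d x₀ := isLocalMin_of_deriv_deriv_pos (by rw [e1, e2]; exact hpos)
    (by rw [e1]; exact h0) (h1 x₀).continuousAt
  have hconst : d =ᶠ[nhds x₀] fun _ => d x₀ := by
    filter_upwards [hmin] with y hy using le_antisymm (hmax y) hy
  have := hconst.deriv.deriv_eq
  rw [e1, e2] at this
  simp at this
  linarith

theorem nonpos_of_max_principle {d d' d'' : ℝ → ℝ} {T : ℝ}
    (h1 : ∀ x, HasDerivAt d (d' x) x) (h2 : ∀ x, HasDerivAt d' (d'' x) x)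
    (hd : Function.Periodic d T) (hT : 0 < T)
    (h : ∀ x, 0 < d x → d' x = 0 → 0 < d'' x) (x : ℝ) : d x ≤ 0 := by
  obtain ⟨x₀, hx₀⟩ := hd.exists_forall_le hT
    (continuous_iff_continuousAt.2 fun x => (h1 x).continuousAt)
  obtain ⟨h3, h4⟩ := deriv_eq_zero_and_second_deriv_nonpos_of_max h1 h2 hx₀
  by_contra! hx
  linarith [h x₀ (hx.trans_le (hx₀ x)) h3]

namespace IsLipschitzForcing
variable {G : ℝ → ℝ → ℝ → ℝ} {L B : ℝ}

/-- Where `v - u` has a positive maximum the slopes agree, so only the dependence of `G` on `u`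
matters, and `(v - u)'' ≥ (K - L)(v - u) > 0`, which is impossible. The period `T` is free because
strands may close up only after several turns. -/
theorem comparison (hG : IsLipschitzForcing G L B) {K : ℝ} (hK : L < K) {T : ℝ} (hT : 0 < T)
    {w v q r u p s : ℝ → ℝ}
    (hv : ∀ x, HasDerivAt v (q x) x) (hq : ∀ x, HasDerivAt q (r x) x)
    (hr : ∀ x, G x (v x) (q x) + K * (v x - w x) ≤ r x)
    (hu : ∀ x, HasDerivAt u (p x) x) (hp : ∀ x, HasDerivAt p (s x) x)
    (hs : ∀ x, s x ≤ G x (u x) (p x) + K * (u x - w x))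
    (hvT : Function.Periodic v T) (huT : Function.Periodic u T) (x : ℝ) : v x ≤ u x := by
  have := nonpos_of_max_principle (fun x => (hv x).sub (hu x)) (fun x => (hq x).sub (hp x))
    (hvT.sub huT) hT (fun x hx hx' => by
      have e : q x = p x := by linarith
      have h1 := hr x
      have h2 := hs x
      have h3 := (abs_le.1 (hG.lip x (v x) (q x) (u x) (p x))).1
      simp only [Pi.sub_apply] at hx
      rw [e, sub_self, abs_zero, add_zero, abs_of_pos hx] at h3
      rw [e] at h1
      nlinarith) x
  simpa using this

/-! ### The implicit time step -/

/-- Right-hand side of the fixed point equation of the implicit time step. -/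
noncomputable def stepMap (hG : IsLipschitzForcing G L B) {k : ℝ} (hk : 0 < k)
    (w h : ℝ →ᵇ ℝ) : ℝ →ᵇ ℝ :=
  BoundedContinuousFunction.ofNormedAddCommGroup
    (fun x => k ^ 2 * w x - G x (greenSol k h x) (greenSolDeriv k h x))
    (by
      have h1 : Continuous (greenSol k h) := continuous_iff_continuousAt.2 fun x =>
        (hasDerivAt_greenSol hk h.continuous (fun y => h.norm_coe_le_norm y) x).continuousAt
      have h2 : Continuous (greenSolDeriv k h) := continuous_iff_continuousAt.2 fun x =>
        (hasDerivAt_greenSolDeriv hk h.continuous (fun y => h.norm_coe_le_norm y) x).continuousAt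
      exact (continuous_const.mul w.continuous).sub
        (hG.cont.comp (continuous_id.prodMk (h1.prodMk h2))))
    (k ^ 2 * ‖w‖ + B)
    (fun x => by
      refine (norm_sub_le _ _).trans (add_le_add ?_ (hG.bdd _ _ _))
      rw [norm_mul, Real.norm_of_nonneg (by positivity)]
      exact mul_le_mul_of_nonneg_left (w.norm_coe_le_norm x) (by positivity))

theorem stepMap_apply (hG : IsLipschitzForcing G L B) {k : ℝ} (hk : 0 < k)
    (w h : ℝ →ᵇ ℝ) (x : ℝ) :
    hG.stepMap hk w h x = k ^ 2 * w x - G x (greenSol k h x) (greenSolDeriv k h x) := rfl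

theorem dist_stepMap_le (hG : IsLipschitzForcing G L B) {k : ℝ} (hk : 0 < k)
    (w₁ w₂ h₁ h₂ : ℝ →ᵇ ℝ) : dist (hG.stepMap hk w₁ h₁) (hG.stepMap hk w₂ h₂) ≤
      k ^ 2 * dist w₁ w₂ + (L / k ^ 2 + L / k) * dist h₁ h₂ := by
  have hL := hG.nonneg
  refine (dist_le (by positivity)).2 fun x => ?_
  rw [Real.dist_eq, stepMap_apply, stepMap_apply]
  have h1 := hG.lip x (greenSol k h₁ x) (greenSolDeriv k h₁ x) (greenSol k h₂ x)
    (greenSolDeriv k h₂ x)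
  have h2 := abs_greenSol_sub_le hk h₁ h₂ x
  have h3 := abs_greenSolDeriv_sub_le hk h₁ h₂ x
  have h4 : |w₁ x - w₂ x| ≤ dist w₁ w₂ := dist_coe_le_dist (f := w₁) (g := w₂) x
  have h5 := mul_le_mul_of_nonneg_left (add_le_add h2 h3) hL
  have h6 : |k ^ 2 * (w₁ x - w₂ x)| ≤ k ^ 2 * dist w₁ w₂ := by
    rw [abs_mul, abs_of_nonneg (by positivity : 0 ≤ k ^ 2)]
    exact mul_le_mul_of_nonneg_left h4 (by positivity)
  calc _ = |k ^ 2 * (w₁ x - w₂ x) - (G x (greenSol k h₁ x) (greenSolDeriv k h₁ x) -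
        G x (greenSol k h₂ x) (greenSolDeriv k h₂ x))| := by ring_nf
    _ ≤ _ := abs_sub _ _
    _ ≤ k ^ 2 * dist w₁ w₂ + L * (dist h₁ h₂ / k ^ 2 + dist h₁ h₂ / k) :=
      add_le_add h6 (h1.trans h5)
    _ = _ := by ring

/-- The unknown is `h = k² z - z''` for the new iterate `z`: the step equation becomes a fixed point
equation for `h`, contracting in the sup norm. The slope bound depends on `w` only through `‖w‖`,
which yields equicontinuity of the iterates. -/
theorem exists_implicitStep (hG : IsLipschitzForcing G L B) {k : ℝ} (hk : 0 < k)
    (hkL : L / k ^ 2 + L / k < 1) :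
    ∃ S : (ℝ →ᵇ ℝ) → (ℝ →ᵇ ℝ), Continuous S ∧ ∀ w : ℝ →ᵇ ℝ, (Function.Periodic w 1 →
        Function.Periodic (S w) 1) ∧
      ∃ p : ℝ → ℝ, (∀ x, HasDerivAt (S w) (p x) x) ∧
      (∀ x, HasDerivAt p (G x (S w x) (p x) + k ^ 2 * (S w x - w x)) x) ∧
      ∀ x, |p x| ≤ (k ^ 2 * ‖w‖ + B) / k := by
  have hL := hG.nonneg
  set c : ℝ := L / k ^ 2 + L / k with hc
  have hc0 : 0 ≤ c := by positivity
  have hcontr : ∀ w, ContractingWith ⟨c, hc0⟩ (hG.stepMap hk w) := fun w =>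
    ⟨by exact_mod_cast hkL, LipschitzWith.of_dist_le_mul fun h₁ h₂ => by
      have := hG.dist_stepMap_le hk w w h₁ h₂
      rwa [dist_self, mul_zero, zero_add] at this⟩
  choose T hT using fun w => (⟨_, (hcontr w).fixedPoint_isFixedPt⟩ : ∃ h, hG.stepMap hk w h = h)
  have hTx : ∀ w x, T w x = k ^ 2 * w x - G x (greenSol k (T w) x) (greenSolDeriv k (T w) x) :=
    fun w x => by conv_lhs => rw [← hT w, stepMap_apply]
  have hbd : ∀ (h : ℝ →ᵇ ℝ) x, |h x| ≤ ‖h‖ := fun h x => h.norm_coe_le_norm x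
  have hTdist : ∀ w₁ w₂, dist (T w₁) (T w₂) ≤ k ^ 2 / (1 - c) * dist w₁ w₂ := fun w₁ w₂ => by
    have h1 := hG.dist_stepMap_le hk w₁ w₂ (T w₁) (T w₂)
    rw [hT, hT, ← hc] at h1
    rw [div_mul_eq_mul_div, le_div_iff₀ (by linarith)]
    linarith
  have hd1 := fun w => hasDerivAt_greenSol hk (T w).continuous (hbd (T w))
  have hd2 := fun w => hasDerivAt_greenSolDeriv hk (T w).continuous (hbd (T w))
  let S : (ℝ →ᵇ ℝ) → (ℝ →ᵇ ℝ) := fun w =>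
    BoundedContinuousFunction.ofNormedAddCommGroup (greenSol k (T w))
      (continuous_iff_continuousAt.2 fun x => (hd1 w x).continuousAt) (‖T w‖ / k ^ 2)
      (fun x => abs_greenSol_le hk (hbd (T w)) x)
  have hSx : ∀ w x, S w x = greenSol k (T w) x := fun _ _ => rfl
  refine ⟨S, ?_, fun w => ⟨fun hw => ?_, greenSolDeriv k (T w), hd1 w, fun x => ?_, fun x => ?_⟩⟩
  · refine (LipschitzWith.of_dist_le_mul (K := (k ^ 2 / (1 - c) / k ^ 2).toNNReal)
      fun w₁ w₂ => ?_).continuous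
    have h1c : 0 < 1 - c := by linarith
    rw [Real.coe_toNNReal _ (by positivity)]
    refine (dist_le (by positivity)).2 fun x => ?_
    refine (abs_greenSol_sub_le hk (T w₁) (T w₂) x).trans ?_
    rw [div_le_iff₀ (by positivity)]
    refine (hTdist w₁ w₂).trans (le_of_eq ?_)
    field_simp
  -- The translate of the fixed point by 1 is again a fixed point; uniqueness gives periodicity.
  · have hfix : hG.stepMap hk w ((T w).compContinuous ⟨fun y => y + 1, by fun_prop⟩) =
        (T w).compContinuous ⟨fun y => y + 1, by fun_prop⟩ := by
      ext x
      have h1 : (⇑((T w).compContinuous ⟨fun y => y + 1, by fun_prop⟩) : ℝ → ℝ) =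
        fun y => T w (y + 1) := rfl
      rw [stepMap_apply, h1, greenSol_comp_add k (T w) 1, greenSolDeriv_comp_add k (T w) 1]
      beta_reduce
      rw [hTx w (x + 1), hw x, hG.periodic]
    have heq := (hcontr w).fixedPoint_unique' (show Function.IsFixedPt _ _ from hfix)
      (show Function.IsFixedPt _ _ from hT w)
    intro x
    rw [hSx, hSx, ← greenSol_comp_add]
    conv_rhs => rw [← heq]
    rfl
  · refine (hd2 w x).congr_deriv ?_
    rw [hTx w x, hSx]
    ring
  · have hle : ‖T w‖ ≤ k ^ 2 * ‖w‖ + B := by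
      have hB : 0 ≤ B := (abs_nonneg _).trans (hG.bdd 0 0 0)
      refine (norm_le (by positivity)).2 fun x => ?_
      rw [hTx]
      refine (norm_sub_le _ _).trans (add_le_add ?_ (hG.bdd _ _ _))
      rw [norm_mul, Real.norm_of_nonneg (by positivity)]
      exact mul_le_mul_of_nonneg_left (w.norm_coe_le_norm x) (by positivity)
    refine (abs_greenSolDeriv_le hk (hbd (T w)) x).trans ?_
    gcongr

/-! ### Monotone iteration between the strands and a supersolution -/

theorem exists_solution_between (hG : IsLipschitzForcing G L B) {ι : Type*} [Nonempty ι]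
    {v q : ι → ℝ → ℝ} {N : ι → ℕ} (hN : ∀ i, 0 < N i) {b R : ℝ}
    (hv : ∀ i x, HasDerivAt (v i) (q i x) x)
    (hq : ∀ i x, HasDerivAt (q i) (G x (v i x) (q i x)) x)
    (hper : ∀ i, Function.Periodic (v i) (N i)) (hR : ∀ i x, -R ≤ v i x) (hbR : b ≤ R)
    (hvb : ∀ i x, v i x ≤ b) (hb : ∀ x, 0 ≤ G x b 0) :
    ∃ u p : ℝ → ℝ, (∀ x, HasDerivAt u (p x) x) ∧ (∀ x, HasDerivAt p (G x (u x) (p x)) x) ∧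
      Function.Periodic u 1 ∧ (∀ i x, v i x ≤ u x) ∧ ∀ x, u x ≤ b := by
  have hL := hG.nonneg
  have i₀ : ι := Classical.arbitrary ι
  have hR0 : 0 ≤ R := by linarith [hR i₀ 0, hvb i₀ 0]
  have hB : 0 ≤ B := (abs_nonneg _).trans (hG.bdd 0 0 0)
  -- Large enough both for the contraction and for the comparison principle with `K = k ^ 2`.
  set k : ℝ := 2 * (L + 1) with hkdef
  have hk : 0 < k := by positivity
  have hkL : L / k ^ 2 + L / k < 1 := by
    rw [div_add_div _ _ (by positivity) (by positivity), div_lt_one (by positivity), hkdef]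
    ring_nf
    nlinarith [pow_nonneg hL 2, pow_nonneg hL 3]
  have hKL : L < k ^ 2 := by rw [hkdef]; nlinarith
  obtain ⟨S, hS, hSw⟩ := hG.exists_implicitStep hk hkL
  have hS1 : ∀ w : ℝ →ᵇ ℝ, Function.Periodic w 1 → (∀ i x, v i x ≤ w x) → ∀ i x,
      v i x ≤ S w x := fun w hw hvw i => by
    obtain ⟨p, hp1, hp2, -⟩ := (hSw w).2
    refine hG.comparison hKL (Nat.cast_pos.2 (hN i)) (w := w) (hv i) (hq i) (fun x => ?_)
      hp1 hp2 (fun x => le_rfl) (hper i) (by simpa using ((hSw w).1 hw).nat_mul (N i))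
    have : k ^ 2 * (v i x - w x) ≤ 0 :=
      mul_nonpos_of_nonneg_of_nonpos (by positivity) (by linarith [hvw i x])
    linarith
  have hS2 : ∀ w : ℝ →ᵇ ℝ, Function.Periodic w 1 → (∀ x, w x ≤ b) → ∀ x, S w x ≤ b :=
      fun w hw hwb => by
    obtain ⟨p, hp1, hp2, -⟩ := (hSw w).2
    refine hG.comparison hKL one_pos (w := w) hp1 hp2 (fun x => le_rfl)
      (u := fun _ => b) (p := fun _ => 0) (s := fun _ => 0)
      (fun x => hasDerivAt_const x b) (fun x => hasDerivAt_const x 0) (fun x => ?_)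
      ((hSw w).1 hw) (fun x => rfl)
    have : 0 ≤ k ^ 2 * (b - w x) := mul_nonneg (by positivity) (by linarith [hwb x])
    linarith [hb x]
  -- Since `w ≤ z`, the step from `z` is a supersolution of the step equation from `w`.
  have hS3 : ∀ w z : ℝ →ᵇ ℝ, Function.Periodic w 1 → Function.Periodic z 1 →
      (∀ x, w x ≤ z x) → ∀ x, S w x ≤ S z x := fun w z hw hz hwz => by
    obtain ⟨p, hp1, hp2, -⟩ := (hSw w).2
    obtain ⟨p', hp1', hp2', -⟩ := (hSw z).2
    refine hG.comparison hKL one_pos (w := w) hp1 hp2 (fun x => le_rfl) hp1' hp2'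
      (fun x => ?_) ((hSw w).1 hw) ((hSw z).1 hz)
    have : 0 ≤ k ^ 2 * (z x - w x) := mul_nonneg (by positivity) (by linarith [hwz x])
    linarith
  set w : ℕ → ℝ →ᵇ ℝ := fun j => S^[j] (BoundedContinuousFunction.const ℝ b) with hw
  have hwS : ∀ j, w (j + 1) = S (w j) := fun j => Function.iterate_succ_apply' S j _
  have hw0 : ∀ x, w 0 x = b := fun x => rfl
  have hwper : ∀ j, Function.Periodic (w j) 1 := fun j => by
    induction j with
    | zero => intro x; rw [hw0, hw0]
    | succ j ih => rw [hwS]; exact (hSw _).1 ih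
  have hwb : ∀ j x, w j x ≤ b := fun j => by
    induction j with
    | zero => intro x; rw [hw0]
    | succ j ih => rw [hwS]; exact hS2 _ (hwper j) ih
  have hvw : ∀ j i x, v i x ≤ w j x := fun j => by
    induction j with
    | zero => intro i x; rw [hw0]; exact hvb i x
    | succ j ih => rw [hwS]; exact hS1 _ (hwper j) ih
  have hwdec : ∀ j x, w (j + 1) x ≤ w j x := fun j => by
    induction j with
    | zero => intro x; rw [hw0]; exact hwb 1 x
    | succ j ih =>
      intro x
      rw [hwS (j + 1)]
      conv_rhs => rw [hwS j]
      exact hS3 _ _ (hwper _) (hwper _) ih x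
  have hanti : ∀ x, Antitone fun j => w j x := fun x => antitone_nat_of_succ_le fun j => hwdec j x
  have hnorm : ∀ j, ‖w j‖ ≤ R := fun j => (norm_le hR0).2 fun x => by
    rw [Real.norm_eq_abs, abs_le]
    exact ⟨(hR i₀ x).trans (hvw j i₀ x), (hwb j x).trans hbR⟩
  set M : ℝ := (k ^ 2 * R + B) / k with hM
  have hM0 : 0 ≤ M := by positivity
  have hwlip : ∀ j x y, dist (w (j + 1) x) (w (j + 1) y) ≤ M * dist x y := fun j x y => by
    obtain ⟨p, hp1, -, hp3⟩ := (hSw (w j)).2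
    rw [hwS, dist_eq_norm, dist_eq_norm]
    refine convex_univ.norm_image_sub_le_of_norm_hasDerivWithin_le
      (fun z _ => (hp1 z).hasDerivWithinAt) (fun z _ => ?_) (mem_univ y) (mem_univ x)
    refine (hp3 z).trans ?_
    have := hnorm j
    rw [hM]
    gcongr
  set u : ℝ → ℝ := fun x => ⨅ j, w j x with hu
  have htend : ∀ x, Filter.Tendsto (fun j => w j x) Filter.atTop (nhds (u x)) := fun x =>
    tendsto_atTop_ciInf (hanti x) ⟨v i₀ x, by rintro _ ⟨j, rfl⟩; exact hvw j i₀ x⟩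
  have hulip : ∀ x y, dist (u x) (u y) ≤ M * dist x y := fun x y =>
    le_of_tendsto (((htend x).comp (Filter.tendsto_add_atTop_nat 1)).dist
      ((htend y).comp (Filter.tendsto_add_atTop_nat 1)))
      (Filter.Eventually.of_forall fun j => hwlip j x y)
  have hucont : Continuous u :=
    (LipschitzWith.of_dist_le_mul (K := M.toNNReal) fun x y => by
      rw [Real.coe_toNNReal _ hM0]; exact hulip x y).continuous
  have huper : Function.Periodic u 1 := fun x => by
    simp only [hu]
    congr 1
    ext j
    exact hwper j x
  have hub : ∀ x, u x ≤ b := fun x => le_of_tendsto' (htend x) fun j => hwb j x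
  have hvu : ∀ i x, v i x ≤ u x := fun i x => ge_of_tendsto' (htend x) fun j => hvw j i x
  -- Dini's theorem on one period, the limit being Lipschitz; periodicity spreads the convergence to
  -- the line. Uniformity lets continuity of `S` identify the limit as a fixed point.
  have hunif : TendstoUniformly (fun j => (w j : ℝ → ℝ)) u Filter.atTop := by
    have h1 := Antitone.tendstoUniformlyOn_of_forall_tendsto (isCompact_Icc (a := (0 : ℝ)) (b := 1))
      (fun j => (w j).continuous.continuousOn) (fun x _ => hanti x) hucont.continuousOn
      (fun x _ => htend x)
    rw [Metric.tendstoUniformlyOn_iff] at h1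
    rw [Metric.tendstoUniformly_iff]
    intro ε hε
    filter_upwards [h1 ε hε] with j hj x
    obtain ⟨y, hy, he⟩ := (huper.sub (hwper j)).exists_mem_Ico₀ one_pos x
    have := hj y (Ico_subset_Icc_self hy)
    rw [Real.dist_eq] at this ⊢
    simp only [Pi.sub_apply] at he
    rwa [he]
  let U : ℝ →ᵇ ℝ := BoundedContinuousFunction.ofNormedAddCommGroup u hucont R fun x => by
    rw [Real.norm_eq_abs, abs_le]
    exact ⟨(hR i₀ x).trans (hvu i₀ x), (hub x).trans hbR⟩
  have hlim : Filter.Tendsto w Filter.atTop (nhds U) :=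
    BoundedContinuousFunction.tendsto_iff_tendstoUniformly.2 hunif
  have hfix : S U = U := isFixedPt_of_tendsto_iterate hlim hS.continuousAt
  obtain ⟨p, hp1, hp2, -⟩ := (hSw U).2
  rw [hfix] at hp1 hp2
  refine ⟨u, p, hp1, fun x => (hp2 x).congr_deriv ?_, huper, hvu, hub⟩
  simp [U]

end IsLipschitzForcing

/-! ### Solving for the second derivative, and truncation -/

/-- The value of `y` truncated to the interval `[-r, r]`. -/
noncomputable def clampAbs (r y : ℝ) : ℝ := max (-r) (min y r)

theorem continuous_clampAbs (r : ℝ) : Continuous (clampAbs r) :=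
  continuous_const.max (continuous_id.min continuous_const)

theorem abs_clampAbs_le {r : ℝ} (hr : 0 ≤ r) (y : ℝ) : |clampAbs r y| ≤ r :=
  abs_le.2 ⟨le_max_left _ _, max_le (by linarith) (min_le_right _ _)⟩

theorem clampAbs_of_abs_le {r y : ℝ} (h : |y| ≤ r) : clampAbs r y = y := by
  rw [clampAbs, min_eq_left (abs_le.1 h).2, max_eq_right (abs_le.1 h).1]

theorem abs_clampAbs_le_abs {r : ℝ} (hr : 0 ≤ r) (y : ℝ) : |clampAbs r y| ≤ |y| := by
  by_cases h : |y| ≤ r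
  · rw [clampAbs_of_abs_le h]
  · exact (abs_clampAbs_le hr y).trans (not_le.1 h).le

theorem abs_clampAbs_sub_le (r y z : ℝ) : |clampAbs r y - clampAbs r z| ≤ |y - z| := by
  have h : LipschitzWith 1 (clampAbs r) := (LipschitzWith.id.min_const r).const_max (-r)
  simpa [Real.dist_eq] using h.dist_le_mul y z

theorem UniformlyParabolic.exists_strongly_monotone {f : ℝ → ℝ → ℝ → ℝ → ℝ}
    (hf : IsCircleNonlinearity f) (hf1 : UniformlyParabolic f) :
    ∃ lam : ℝ, 0 < lam ∧ ∀ x u v w₁ w₂, w₁ ≤ w₂ →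
      lam * (w₂ - w₁) ≤ f x u v w₂ - f x u v w₁ := by
  obtain ⟨lam, hl, h⟩ := hf1
  refine ⟨lam, hl, fun x u v w₁ w₂ hw => ?_⟩
  refine mul_sub_le_image_sub_of_le_deriv (f := fun s => f x u v s) ?_ (fun w => (h x u v w).1) hw
  exact (hf.contDiff.differentiable one_ne_zero).comp (f := fun s : ℝ => (x, u, v, s))
    (by fun_prop)

/-- The equation `f(x,u,v,w) = 0` solved for `w`, with quantitative dependence on the data. -/
theorem exists_implicit_solution {f : ℝ → ℝ → ℝ → ℝ → ℝ}
    (hf : IsCircleNonlinearity f) (hf1 : UniformlyParabolic f) :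
    ∃ (g : ℝ → ℝ → ℝ → ℝ) (lam : ℝ), 0 < lam ∧ (∀ x u v w, f x u v w = 0 ↔ w = g x u v) ∧
      ∀ x u v w, lam * |g x u v - w| ≤ |f x u v w| := by
  obtain ⟨lam, hl, hmono⟩ := hf1.exists_strongly_monotone hf
  have habs : ∀ x u v w₁ w₂, lam * |w₂ - w₁| ≤ |f x u v w₂ - f x u v w₁| := fun x u v w₁ w₂ => by
    rcases le_total w₁ w₂ with h | h
    · rw [abs_of_nonneg (by linarith : 0 ≤ w₂ - w₁)]
      exact (hmono x u v _ _ h).trans (le_abs_self _)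
    · rw [abs_sub_comm, abs_sub_comm (f x u v w₂), abs_of_nonneg (by linarith : 0 ≤ w₁ - w₂)]
      exact (hmono x u v _ _ h).trans (le_abs_self _)
  have hex : ∀ x u v, ∃ w, f x u v w = 0 := fun x u v => by
    have hc : Continuous fun s => f x u v s :=
      hf.contDiff.continuous.comp (f := fun s : ℝ => (x, u, v, s)) (by fun_prop)
    -- As `f` increases in `w` at rate at least `lam`, its zero lies within this distance of 0.
    set r := |f x u v 0| / lam with hr
    have hr0 : 0 ≤ r := by positivity
    have hlr : lam * r = |f x u v 0| := by rw [hr]; field_simp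
    have h1 := hmono x u v 0 r hr0
    have h2 := hmono x u v (-r) 0 (by linarith)
    have h3 := abs_le.1 (le_refl |f x u v 0|)
    obtain ⟨w, -, hw⟩ := intermediate_value_Icc (by linarith : -r ≤ r) hc.continuousOn
      (show (0 : ℝ) ∈ Icc (f x u v (-r)) (f x u v r) from ⟨by linarith, by linarith⟩)
    exact ⟨w, hw⟩
  choose g hg using hex
  refine ⟨g, lam, hl, fun x u v w => ⟨fun h => ?_, fun h => h ▸ hg x u v⟩, fun x u v w => ?_⟩
  · have := habs x u v (g x u v) w
    rw [h, hg, sub_self, abs_zero] at this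
    have h0 := abs_nonpos_iff.1 (nonpos_of_mul_nonpos_right this hl)
    linarith
  · simpa [hg] using habs x u v w (g x u v)

/-- Applying `hlip` at `w = g x u' v'`, where `f x u' v' w = 0`, bounds the variation of `g` by that
of `f` in `(u,v)` at fixed `w`. On the compact box cut out by `R`, `N`, `B` the `C¹` function `f` is
Lipschitz. -/
theorem isLipschitzForcing_truncation {f : ℝ → ℝ → ℝ → ℝ → ℝ} (hf : IsCircleNonlinearity f)
    {g : ℝ → ℝ → ℝ → ℝ} {lam : ℝ} (hl : 0 < lam)
    (hg : ∀ x u v w, f x u v w = 0 ↔ w = g x u v)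
    (hlip : ∀ x u v w, lam * |g x u v - w| ≤ |f x u v w|)
    {R N B : ℝ} (hR : 0 ≤ R) (hN : 0 ≤ N) (hB : ∀ x u v, |u| ≤ R → |v| ≤ N → |g x u v| ≤ B) :
    ∃ L, IsLipschitzForcing (fun x u v => g x (clampAbs R u) (clampAbs N v)) L B := by
  have hg0 : ∀ x u v, f x u v (g x u v) = 0 := fun x u v => (hg x u v _).2 rfl
  have hgper : ∀ x u v, g (x + 1) u v = g x u v := fun x u v => by
    rw [← hg x u v, ← hf.periodic]
    exact hg0 _ _ _
  have hgc : Continuous fun p : ℝ × ℝ × ℝ => g p.1 p.2.1 p.2.2 := by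
    refine continuous_iff_continuousAt.2 fun p₀ => ?_
    set w₀ := g p₀.1 p₀.2.1 p₀.2.2 with hw₀
    have h1 : Continuous fun p : ℝ × ℝ × ℝ => |f p.1 p.2.1 p.2.2 w₀| / lam :=
      ((hf.contDiff.continuous.comp (f := fun p : ℝ × ℝ × ℝ => (p.1, p.2.1, p.2.2, w₀))
        (by fun_prop)).abs).div_const lam
    have h2 := h1.tendsto p₀
    rw [hw₀, hg0, abs_zero, zero_div, ← hw₀] at h2
    refine tendsto_iff_dist_tendsto_zero.2 (squeeze_zero (fun _ => dist_nonneg) (fun p => ?_) h2)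
    rw [Real.dist_eq, le_div_iff₀ hl, mul_comm]
    exact hlip _ _ _ _
  obtain ⟨K, hK⟩ := (hf.contDiff.locallyLipschitz.locallyLipschitzOn
    (s := Icc (0 : ℝ) 1 ×ˢ Icc (-R) R ×ˢ Icc (-N) N ×ˢ Icc (-B) B)).exists_lipschitzOnWith_of_compact
    (isCompact_Icc.prod (isCompact_Icc.prod (isCompact_Icc.prod isCompact_Icc)))
  have key : ∀ x u v u' v', |u| ≤ R → |u'| ≤ R → |v| ≤ N → |v'| ≤ N →
      |g x u v - g x u' v'| ≤ K / lam * (|u - u'| + |v - v'|) := fun x u v u' v' h1 h2 h3 h4 => by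
    obtain ⟨y, hy, he⟩ := Function.Periodic.exists_mem_Ico₀
      (f := fun x => (g x u v, g x u' v')) (fun x => by simp [hgper]) one_pos x
    simp only [Prod.mk.injEq] at he
    rw [he.1, he.2]
    have hb := abs_le.1 (hB y u' v' h2 h4)
    have hy' := Ico_subset_Icc_self hy
    have hd := hK.dist_le_mul (y, u, v, g y u' v') ⟨hy', abs_le.1 h1, abs_le.1 h3, hb⟩
      (y, u', v', g y u' v') ⟨hy', abs_le.1 h2, abs_le.1 h4, hb⟩
    simp only [hg0, Real.dist_eq, sub_zero, Prod.dist_eq, sub_self, abs_zero] at hd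
    have hmax : max 0 (max |u - u'| (max |v - v'| 0)) ≤ |u - u'| + |v - v'| := by
      have := abs_nonneg (u - u')
      have := abs_nonneg (v - v')
      simp only [max_le_iff]
      refine ⟨?_, ?_, ?_, ?_⟩ <;> linarith
    have := (hlip y u v (g y u' v')).trans
      (hd.trans (mul_le_mul_of_nonneg_left hmax K.coe_nonneg))
    rw [div_mul_eq_mul_div, le_div_iff₀ hl]
    linarith
  refine ⟨K / lam, ⟨by positivity, ?_, fun x u v => hB _ _ _ (abs_clampAbs_le hR u)
    (abs_clampAbs_le hN v), fun x u v u' v' => ?_, fun x u v => hgper _ _ _⟩⟩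
  · exact hgc.comp (f := fun p : ℝ × ℝ × ℝ => (p.1, clampAbs R p.2.1, clampAbs N p.2.2))
      (continuous_fst.prodMk (((continuous_clampAbs R).comp (by fun_prop)).prodMk
        ((continuous_clampAbs N).comp (by fun_prop))))
  · refine (key _ _ _ _ _ (abs_clampAbs_le hR u) (abs_clampAbs_le hR u') (abs_clampAbs_le hN v)
      (abs_clampAbs_le hN v')).trans ?_
    have := abs_clampAbs_sub_le R u u'
    have := abs_clampAbs_sub_le N v v'
    gcongr

/-! ### Nagumo's gradient bound -/

theorem exists_forall_mul_one_add_rpow_lt_sq {γ : ℝ} (hγ : γ < 2) (a : ℝ) :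
    ∃ N : ℝ, 1 ≤ N ∧ ∀ S, N ≤ S → a * (1 + S ^ γ) < S ^ 2 := by
  have h1 := (tendsto_rpow_atTop (by linarith : 0 < 2 - γ)).eventually_gt_atTop (2 * |a|)
  have h2 := (Filter.tendsto_pow_atTop (two_ne_zero (α := ℕ)) (α := ℝ)).eventually_gt_atTop
    (2 * |a|)
  obtain ⟨N, hN⟩ := Filter.eventually_atTop.1 (h1.and h2)
  refine ⟨max 1 N, le_max_left _ _, fun S hS => ?_⟩
  have hS1 : 0 < S := by linarith [le_max_left 1 N]
  obtain ⟨h3, h4⟩ := hN S ((le_max_right _ _).trans hS)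
  have hpos := Real.rpow_pos_of_pos hS1 γ
  have h5 : S ^ γ * S ^ (2 - γ) = S ^ 2 := by
    rw [← Real.rpow_add hS1, ← Real.rpow_natCast]
    norm_num
  have h6 := mul_lt_mul_of_pos_left h3 hpos
  have h7 := mul_le_mul_of_nonneg_right (le_abs_self a) (by positivity : 0 ≤ 1 + S ^ γ)
  linarith

/-- Nagumo's gradient bound for periodic functions whose second derivative grows subquadratically
in the first derivative. -/
theorem abs_deriv_lt_of_subquadratic {u p s : ℝ → ℝ} {T R D γ N : ℝ} (hT : 0 < T) (hR : 0 < R)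
    (hD : 0 ≤ D) (hγ : 0 < γ) (hN1 : 1 ≤ N) (hN : ∀ S, N ≤ S → 8 * R * D * (1 + S ^ γ) < S ^ 2)
    (hu : ∀ x, HasDerivAt u (p x) x) (hp : ∀ x, HasDerivAt p (s x) x)
    (hper : Function.Periodic u T) (huR : ∀ x, |u x| ≤ R)
    (hs : ∀ x, |s x| ≤ D * (1 + |p x| ^ γ)) (x : ℝ) : |p x| < N := by
  have hpper : Function.Periodic p T := fun x => by
    have h1 := (hu (x + T)).comp_add_const x T
    exact (h1.congr_of_eventuallyEq (Filter.Eventually.of_forall fun y => (hper y).symm)).unique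
      (hu x)
  have hpc : Continuous p := continuous_iff_continuousAt.2 fun x => (hp x).continuousAt
  obtain ⟨x₀, hx₀⟩ := Function.Periodic.exists_forall_le (d := fun x => |p x|)
    (fun x => by simp only [hpper x]) hT hpc.abs
  refine (hx₀ x).trans_lt ?_
  by_contra! hS
  set S := |p x₀| with hSdef
  have hS0 : 0 < S := by linarith
  -- Over this length `|u| ≤ R` keeps the mean slope at most `S / 2` in size, so `p` must change by
  -- `S / 2` within it. The bound on `s` then gives `S ^ 2 ≤ 8 * R * D * (1 + S ^ γ)`, against the
  -- choice of `N`.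
  set δ := 4 * R / S with hδ
  have hδ0 : 0 < δ := by positivity
  obtain ⟨ξ, hξ, he⟩ := exists_hasDerivAt_eq_slope u p (by linarith : x₀ < x₀ + δ)
    (fun y _ => (hu y).continuousAt.continuousWithinAt) (fun y _ => hu y)
  have h1 : |p ξ| ≤ S / 2 := by
    rw [he, abs_div, add_sub_cancel_left, abs_of_pos hδ0, div_le_iff₀ hδ0]
    have : S / 2 * δ = 2 * R := by rw [hδ]; field_simp; ring
    rw [this]
    exact (abs_sub _ _).trans (by linarith [huR (x₀ + δ), huR x₀])
  have h2 : |p ξ - p x₀| ≤ D * (1 + S ^ γ) * |ξ - x₀| := by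
    refine convex_univ.norm_image_sub_le_of_norm_hasDerivWithin_le
      (fun z _ => (hp z).hasDerivWithinAt) (fun z _ => (hs z).trans ?_) (mem_univ x₀) (mem_univ ξ)
    have := Real.rpow_le_rpow (abs_nonneg _) (hx₀ z) hγ.le
    gcongr
  have hpos := Real.rpow_pos_of_pos hS0 γ
  have h3 : |ξ - x₀| ≤ δ := by rw [abs_of_pos (by linarith [hξ.1])]; linarith [hξ.2]
  have h4 : S ≤ |p ξ| + |p ξ - p x₀| := by
    have := abs_sub_abs_le_abs_sub (p x₀) (p ξ)
    rw [abs_sub_comm] at this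
    linarith
  have h5 : D * (1 + S ^ γ) * |ξ - x₀| ≤ D * (1 + S ^ γ) * δ :=
    mul_le_mul_of_nonneg_left h3 (by positivity)
  have h6 : S / 2 ≤ D * (1 + S ^ γ) * δ := by linarith
  have h7 : D * (1 + S ^ γ) * δ * (2 * S) = 8 * R * D * (1 + S ^ γ) := by
    rw [hδ]; field_simp; ring
  have h8 := mul_le_mul_of_nonneg_right h6 (by positivity : 0 ≤ 2 * S)
  have h9 := hN S hS
  rw [h7] at h8
  nlinarith

/-! ### ODE uniqueness and periodic stationary solutions above a family -/

theorem IsLipschitzForcing.eq_of_initial_eq {G : ℝ → ℝ → ℝ → ℝ} {L B : ℝ}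
    (hG : IsLipschitzForcing G L B) {u p v q : ℝ → ℝ}
    (hu : ∀ x, HasDerivAt u (p x) x) (hp : ∀ x, HasDerivAt p (G x (u x) (p x)) x)
    (hv : ∀ x, HasDerivAt v (q x) x) (hq : ∀ x, HasDerivAt q (G x (v x) (q x)) x)
    {x₀ : ℝ} (h0 : u x₀ = v x₀) (h1 : p x₀ = q x₀) : u = v := by
  have hL := hG.nonneg
  have key := ODE_solution_unique_univ (v := fun x (z : ℝ × ℝ) => (z.2, G x z.1 z.2))
    (s := fun _ => univ) (K := (1 + 2 * L).toNNReal) (t₀ := x₀)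
    (f := fun x => (u x, p x)) (g := fun x => (v x, q x))
    (fun x => (LipschitzWith.of_dist_le_mul fun a b => ?_).lipschitzOnWith)
    (fun x => ⟨(hu x).prodMk (hp x), mem_univ _⟩) (fun x => ⟨(hv x).prodMk (hq x), mem_univ _⟩)
    (by simp [h0, h1])
  · funext x
    exact congrArg Prod.fst (congrFun key x)
  · rw [Real.coe_toNNReal _ (by positivity)]
    have h1 : |a.1 - b.1| ≤ dist a b := le_max_left _ _
    have h2 : |a.2 - b.2| ≤ dist a b := le_max_right _ _
    have h3 := hG.lip x a.1 a.2 b.1 b.2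
    have h4 := mul_le_mul_of_nonneg_left (add_le_add h1 h2) hL
    have h5 : 0 ≤ dist a b := dist_nonneg
    refine max_le ?_ ?_ <;> simp only [Real.dist_eq]
    · nlinarith [mul_nonneg hL h5]
    · linarith

theorem IsStationarySolution.hasDerivAt {f : ℝ → ℝ → ℝ → ℝ → ℝ} {u : ℝ → ℝ}
    (hu : IsStationarySolution f u) (x : ℝ) : HasDerivAt u (deriv u x) x :=
  (hu.1.differentiable two_ne_zero x).hasDerivAt

theorem IsStationarySolution.hasDerivAt_deriv {f : ℝ → ℝ → ℝ → ℝ → ℝ} {u : ℝ → ℝ}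
    (hu : IsStationarySolution f u) (x : ℝ) : HasDerivAt (deriv u) (deriv (deriv u) x) x := by
  have h := hu.1
  rw [show (2 : WithTop ℕ∞) = 1 + 1 by norm_num, contDiff_succ_iff_deriv] at h
  exact (h.2.2.differentiable one_ne_zero x).hasDerivAt

/-- Existence of a periodic stationary solution above a finite family of periodic stationary
solutions and below a constant strict supersolution; it meets a member of the family only if it
coincides with it. -/
theorem exists_periodic_stationary_above {f : ℝ → ℝ → ℝ → ℝ → ℝ} (hf : IsCircleNonlinearity f)
    (hf1 : UniformlyParabolic f) (hf2 : SubquadraticGrowth f) {ι : Type*} [Fintype ι] [Nonempty ι]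
    {v : ι → ℝ → ℝ} {T : ι → ℕ} (hv : ∀ i, IsStationarySolution f (v i)) (hT : ∀ i, 0 < T i)
    (hper : ∀ i, Function.Periodic (v i) (T i)) {b : ℝ} (hvb : ∀ i x, v i x < b)
    (hb : ∀ x, f x b 0 0 < 0) :
    ∃ u : ℝ → ℝ, IsStationarySolution f u ∧ Function.Periodic u 1 ∧ (∀ i x, v i x ≤ u x) ∧
      (∀ x, u x < b) ∧ ∀ i x, u x = v i x → u = v i := by
  obtain ⟨g, lam, hl, hg, hlip⟩ := exists_implicit_solution hf hf1
  obtain ⟨γ, hγ0, hγ2, hgrow⟩ := hf2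
  have hT' : ∀ i, (0 : ℝ) < T i := fun i => Nat.cast_pos.2 (hT i)
  have hM : ∀ i, ∃ M, ∀ x, |v i x| ≤ M := fun i => by
    obtain ⟨x₀, hx₀⟩ := Function.Periodic.exists_forall_le (d := fun x => |v i x|)
      (fun x => by simp only [hper i x]) (hT' i) (hv i).1.continuous.abs
    exact ⟨_, hx₀⟩
  choose M hM using hM
  have hM0 : ∀ i, 0 ≤ M i := fun i => (abs_nonneg _).trans (hM i 0)
  set R : ℝ := 1 + |b| + ∑ i, M i with hR
  have hsum : 0 ≤ ∑ i, M i := Finset.sum_nonneg fun i _ => hM0 i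
  have hR0 : 0 < R := by positivity
  have hvR : ∀ i x, |v i x| ≤ R := fun i x => by
    have := Finset.single_le_sum (f := M) (fun i _ => hM0 i) (Finset.mem_univ i)
    linarith [hM i x, abs_nonneg b]
  have hbR : |b| ≤ R := by linarith
  obtain ⟨C, hC, hgrow⟩ := hgrow R
  have hgD : ∀ x u v, |u| ≤ R → |g x u v| ≤ C / lam * (1 + |v| ^ γ) := fun x u v hu => by
    have h1 := (hlip x u v 0).trans (hgrow x u v 0 hu (by simpa using hR0.le))
    rw [sub_zero] at h1
    rw [div_mul_eq_mul_div, le_div_iff₀ hl]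
    linarith
  have hD : 0 ≤ C / lam := by positivity
  obtain ⟨N, hN1, hN⟩ := exists_forall_mul_one_add_rpow_lt_sq hγ2 (8 * R * (C / lam))
  have hN0 : 0 ≤ N := by linarith
  obtain ⟨L, hG⟩ := isLipschitzForcing_truncation hf hl hg hlip hR0.le hN0
    (B := C / lam * (1 + N ^ γ)) fun x u v hu hv => (hgD x u v hu).trans (by
      have := Real.rpow_le_rpow (abs_nonneg _) hv hγ0.le
      gcongr)
  set G : ℝ → ℝ → ℝ → ℝ := fun x u v => g x (clampAbs R u) (clampAbs N v) with hGdef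
  have hGg : ∀ x u v, |u| ≤ R → |v| ≤ N → G x u v = g x u v := fun x u v hu hv => by
    simp only [hGdef, clampAbs_of_abs_le hu, clampAbs_of_abs_le hv]
  have hvg : ∀ i x, deriv (deriv (v i)) x = g x (v i x) (deriv (v i) x) := fun i x =>
    (hg _ _ _ _).1 ((hv i).2 x)
  -- The strands obey the gradient bound, so they also solve the truncated equation and serve as
  -- lower barriers.
  have hvN : ∀ i x, |deriv (v i) x| < N := fun i =>
    abs_deriv_lt_of_subquadratic (hT' i) hR0 hD hγ0 hN1 hN (hv i).hasDerivAt
      (hv i).hasDerivAt_deriv (hper i) (hvR i) fun x => by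
        rw [hvg]; exact hgD _ _ _ (hvR i x)
  have hvG : ∀ i x, HasDerivAt (deriv (v i)) (G x (v i x) (deriv (v i) x)) x := fun i x =>
    ((hv i).hasDerivAt_deriv x).congr_deriv (by rw [hGg _ _ _ (hvR i x) (hvN i x).le, hvg])
  -- `f x b 0` is increasing and negative at 0, so its zero `g x b 0` cannot be negative.
  have hGb : ∀ x, 0 ≤ G x b 0 := fun x => by
    rw [hGg _ _ _ hbR (by simpa using hN0)]
    obtain ⟨lam', hl', hmono⟩ := hf1.exists_strongly_monotone hf
    by_contra! h
    have h1 := hmono x b 0 _ _ h.le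
    rw [(hg x b 0 _).2 rfl, sub_zero] at h1
    nlinarith [hb x]
  obtain ⟨u, p, hu, hp, huper, hvu, hub⟩ := hG.exists_solution_between hT
    (fun i => (hv i).hasDerivAt) hvG hper (fun i x => (abs_le.1 (hvR i x)).1)
    ((le_abs_self b).trans hbR) (fun i x => (hvb i x).le) hGb
  have i₀ : ι := Classical.arbitrary ι
  have huR : ∀ x, |u x| ≤ R := fun x =>
    abs_le.2 ⟨(abs_le.1 (hvR i₀ x)).1.trans (hvu i₀ x),
      (hub x).trans ((le_abs_self b).trans hbR)⟩
  -- Truncating `p` only lowers its absolute value, so the same growth bound, hence the same `N`,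
  -- serves the truncated equation.
  have hpN : ∀ x, |p x| < N :=
    abs_deriv_lt_of_subquadratic one_pos hR0 hD hγ0 hN1 hN hu hp huper huR fun x => by
      simp only [hGdef, clampAbs_of_abs_le (huR x)]
      refine (hgD _ _ _ (huR x)).trans ?_
      have := Real.rpow_le_rpow (abs_nonneg _) (abs_clampAbs_le_abs hN0 (p x)) hγ0.le
      gcongr
  have hd1 : deriv u = p := funext fun x => (hu x).deriv
  have hd2 : deriv p = fun x => G x (u x) (p x) := funext fun x => (hp x).deriv
  have huc : Continuous u := continuous_iff_continuousAt.2 fun x => (hu x).continuousAt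
  have hpc : Continuous p := continuous_iff_continuousAt.2 fun x => (hp x).continuousAt
  have hust : IsStationarySolution f u := by
    refine ⟨?_, fun x => ?_⟩
    · rw [show (2 : WithTop ℕ∞) = 1 + 1 by norm_num, contDiff_succ_iff_deriv, hd1,
        contDiff_one_iff_deriv, hd2]
      exact ⟨fun x => (hu x).differentiableAt, by simp, fun x => (hp x).differentiableAt,
        hG.cont.comp (continuous_id.prodMk (huc.prodMk hpc))⟩
    · rw [hd1, hd2]
      exact (hg _ _ _ _).2 (hGg _ _ _ (huR x) (hpN x).le)
  refine ⟨u, hust, huper, hvu, fun x => (hub x).lt_of_ne fun he => ?_, fun i x he => ?_⟩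
  -- At a contact with `b`, `u` is maximal: its slope is 0 and its second derivative is nonpositive,
  -- so monotonicity in `w` gives `f ≤ f x b 0 0 < 0` there.
  · obtain ⟨h1, h2⟩ := deriv_eq_zero_and_second_deriv_nonpos_of_max hu hp
      (x₀ := x) (fun y => by rw [he]; exact hub y)
    have h3 := hust.2 x
    obtain ⟨lam', hl', hmono⟩ := hf1.exists_strongly_monotone hf
    rw [hd1, hd2] at h3
    beta_reduce at h3
    rw [h1, he] at h3
    rw [h1, he] at h2
    have h4 := hmono x b 0 _ _ h2
    rw [h3] at h4
    nlinarith [hb x]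
  · refine hG.eq_of_initial_eq hu hp (hv i).hasDerivAt (hvG i) (x₀ := x) he ?_
    have hmin : IsLocalMin (fun y => u y - v i y) x := Filter.Eventually.of_forall fun y => by
      simp only [he, sub_self, sub_nonneg, hvu i y]
    linarith [hmin.hasDerivAt_eq_zero ((hu x).sub ((hv i).hasDerivAt x))]

/-! ### Braids, reflection and conclusion -/

theorem periodic_of_periodic_perm {n : ℕ} {τ : Equiv.Perm (Fin n)} {v : Fin n → ℝ → ℝ}
    (h : ∀ α x, v α (x + 1) = v (τ α) x) (α : Fin n) :
    Function.Periodic (v α) (orderOf τ : ℕ) := by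
  have key : ∀ (m : ℕ) α x, v α (x + m) = v ((τ ^ m) α) x := fun m => by
    induction m with
    | zero => intro α x; simp
    | succ m ih =>
      intro α x
      rw [Nat.cast_succ, ← add_assoc, h, ih, pow_succ, Equiv.Perm.mul_apply]
  intro x
  rw [key, pow_orderOf_eq_one, Equiv.Perm.one_apply]

theorem exists_periodic_stationary_above_braid {f : ℝ → ℝ → ℝ → ℝ → ℝ}
    (hf : IsCircleNonlinearity f) (hf1 : UniformlyParabolic f) (hf2 : SubquadraticGrowth f)
    {n : ℕ} [NeZero n] {τ : Equiv.Perm (Fin n)} {v : Fin n → ℝ → ℝ}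
    (hv : ∀ α, IsStationarySolution f (v α)) (hper : ∀ α x, v α (x + 1) = v (τ α) x)
    (htop : ¬ HasTopStrand v) {b : ℝ} (hvb : ∀ α x, v α x < b) (hb : ∀ x, f x b 0 0 < 0) :
    ∃ u : ℝ → ℝ, IsStationarySolution f u ∧ Function.Periodic u 1 ∧
      ∀ x, (∀ α, v α x < u x) ∧ u x < b := by
  obtain ⟨u, hu, hup, hvu, hub, huv⟩ := exists_periodic_stationary_above hf hf1 hf2 hv
    (fun _ => orderOf_pos τ) (periodic_of_periodic_perm hper) hvb hb
  refine ⟨u, hu, hup, fun x => ⟨fun α => (hvu α x).lt_of_ne fun he => htop ⟨α, fun β y => ?_⟩,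
    hub x⟩⟩
  rw [← huv α x he.symm]
  exact hvu β y

section Reflection
variable {f : ℝ → ℝ → ℝ → ℝ → ℝ}

theorem IsCircleNonlinearity.reflect (hf : IsCircleNonlinearity f) :
    IsCircleNonlinearity fun x u v w => -f x (-u) (-v) (-w) where
  contDiff := (hf.contDiff.comp (f := fun p : ℝ × ℝ × ℝ × ℝ =>
    (p.1, -p.2.1, -p.2.2.1, -p.2.2.2)) (by fun_prop)).neg
  periodic x u v w := by simp only [hf.periodic]

theorem UniformlyParabolic.reflect (hf : UniformlyParabolic f) :
    UniformlyParabolic fun x u v w => -f x (-u) (-v) (-w) := by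
  obtain ⟨lam, hl, h⟩ := hf
  refine ⟨lam, hl, fun x u v w => ?_⟩
  have : deriv (fun s => -f x (-u) (-v) (-s)) w = deriv (fun s => f x (-u) (-v) s) (-w) := by
    rw [deriv.fun_neg, deriv_comp_neg (fun s => f x (-u) (-v) s) w, neg_neg]
  rw [this]
  exact h _ _ _ _

theorem SubquadraticGrowth.reflect (hf : SubquadraticGrowth f) :
    SubquadraticGrowth fun x u v w => -f x (-u) (-v) (-w) := by
  obtain ⟨γ, h0, h2, h⟩ := hf
  refine ⟨γ, h0, h2, fun R => ?_⟩
  obtain ⟨C, hC, h⟩ := h R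
  refine ⟨C, hC, fun x u v w hu hw => ?_⟩
  simpa using h x (-u) (-v) (-w) (by simpa using hu) (by simpa using hw)

theorem IsStationarySolution.reflect {u : ℝ → ℝ} (hu : IsStationarySolution f u) :
    IsStationarySolution (fun x u v w => -f x (-u) (-v) (-w)) fun x => -u x := by
  have e : ∀ u : ℝ → ℝ, deriv (fun x => -u x) = fun x => -deriv u x := fun u =>
    funext fun x => deriv.fun_neg
  refine ⟨hu.1.neg, fun x => ?_⟩
  rw [e, e]
  simpa using hu.2 x

end Reflection

theorem mainTheorem7 (f : ℝ → ℝ → ℝ → ℝ → ℝ) (hf : IsCircleNonlinearity f)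
    (hf1 : UniformlyParabolic f) (hf2 : SubquadraticGrowth f)
    {n : ℕ} (τ : Equiv.Perm (Fin n)) (v : Fin n → ℝ → ℝ)
    (hv : IsStationaryBraid f τ v) (hbraided : braidLength v ≠ 0) :
    (¬ HasTopStrand v →
      ∀ ustar : ℝ, (∀ α x, v α x < ustar) → (∀ x, f x ustar 0 0 < 0) →
        ∃ u : ℝ → ℝ, IsStationarySolution f u ∧ Function.Periodic u 1 ∧
          ∀ x, (∀ α, v α x < u x) ∧ u x < ustar) ∧
    (¬ HasBottomStrand v →
      ∀ ustar : ℝ, (∀ α x, ustar < v α x) → (∀ x, 0 < f x ustar 0 0) →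
        ∃ u : ℝ → ℝ, IsStationarySolution f u ∧ Function.Periodic u 1 ∧
          ∀ x, ustar < u x ∧ (∀ α, u x < v α x)) := by
  -- A braid with an intersection has a strand, so the lower barrier is not vacuous.
  have : NeZero n := ⟨by
    rintro rfl
    refine hbraided (Set.encard_eq_zero.2 (Set.eq_empty_of_forall_notMem fun p _ => ?_))
    exact p.1.1.elim0⟩
  refine ⟨fun htop b hvb hb =>
    exists_periodic_stationary_above_braid hf hf1 hf2 hv.stationary hv.periodic htop hvb hb,
    fun hbot b hvb hb => ?_⟩
  -- The reflection `u ↦ -u` turns bottom strands into top strands and the subsolution `b` into the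
  -- supersolution `-b`.
  obtain ⟨u, hu, hup, hux⟩ := exists_periodic_stationary_above_braid hf.reflect hf1.reflect
    hf2.reflect (v := fun α x => -v α x) (τ := τ) (b := -b) (fun α => (hv.stationary α).reflect)
    (fun α x => by simp only [hv.periodic])
    (fun ⟨α, h⟩ => hbot ⟨α, fun β x => neg_le_neg_iff.1 (h β x)⟩)
    (fun α x => neg_lt_neg (hvb α x)) (fun x => by simpa using hb x)
  refine ⟨fun x => -u x, by simpa using hu.reflect, fun x => by simp only [hup x], fun x =>
    ⟨by linarith [(hux x).2], fun α => by linarith [(hux x).1 α]⟩⟩
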